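/- Notation. For $Z\in\mathbb{R}^{d\times n}$ the columns $Z_{:,k}$ are its tokens, $\|\cdot\|$ is the Euclidean norm, $\sigma_S$ is the column-wise softmax and $\sigma_R(x)=\max(x,0)$ is applied entrywise. A one-layer single-head Transformer with head size $s$ and hidden dimension $q$ is the map $\mathcal F=\mathcal F^{(FF)}\circ\mathcal F^{(SA)}_S:\mathbb{R}^{d\times n}\to\mathbb{R}^{d\times n}$, $$\mathcal F^{(SA)}_S(Z)=Z+W^{(O)}\big(W^{(V)}Z\big)\,\sigma_S\big[(W^{(K)}Z)^\top(W^{(Q)}Z)\big],$$ $$\mathcal F^{(FF)}(H)_{:,k}=H_{:,k}+W^{(2)}\sigma_R\big[W^{(1)}H_{:,k}+b^{(1)}\big]+b^{(2)},$$ with $W^{(O)}\in\mathbb{R}^{d\times s}$, $W^{(V)},W^{(K)},W^{(Q)}\in\mathbb{R}^{s\times d}$, $W^{(1)}\in\mathbb{R}^{q\times d}$, $W^{(2)}\in\mathbb{R}^{d\times q}$, $b^{(1)}\in\mathbb{R}^q$, $b^{(2)}\in\mathbb{R}^d$. Sequences $X^{(1)},\dots,X^{(N)}\in\mathbb{R}^{d\times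 n}$ are tokenwise $(r_{\min},r_{\max},\epsilon)$-separated if $r_{\min}<\|X^{(i)}_{:,k}\|<r_{\max}$ for all $i,k$, and $\|X^{(i)}_{:,k}-X^{(j)}_{:,l}\|>\epsilon$ for all $i,j,k,l$ with $X^{(i)}_{:,k}\neq X^{(j)}_{:,l}$. Architecture. Consider the following family of such Transformers, with hidden dimension $q=d\cdot nN$. Each of the four attention matrices is an outer product of a vector in $\mathbb{R}^d$ and a vector in $\mathbb{R}^s$. The hidden units are indexed by $(c,j)\in[d]\times[nN]$; with $a_c\in\mathbb{R}^d$ and $\beta_{c},w_{c}\in\mathbb{R}^{nN}$ for $c\in[d]$, the row $(c,j)$ of $W^{(1)}$ is $a_c^\top$, $b^{(1)}_{(c,j)}=\beta_{c,j}$, $W^{(2)}_{c',(c,j)}=w_{c,j}$ if $c'=c$ and $0$ otherwise, and $b^{(2)}=0$. This family, which depends only on $d,n,N,s$, has exactly $4(s+d)+d(2nN+d)$ free real parameters. Statement. Let $s\ge 1$, $\epsilon>0$, $r_{\max}>r_{\min}>0$, and let $(X^{(1)},Y^{(1)}),\dots,(X^{(N)},Y^{(N)})\in\mathbb{R}^{d\times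 n}\times\{1,\dots,C\}^{d\times n}$ be input-output pairs such that $X^{(1)},\dots,X^{(N)}$ are tokenwise $(r_{\min},r_{\max},\epsilon)$-separated (repeated tokens within a sequence are allowed) and consistently labeled, that is, $Y^{(i)}=Y^{(j)}$ whenever $X^{(i)}=X^{(j)}$. Then there exist values of the $4(s+d)+d(2nN+d)$ free parameters of the above family and a positional encoding $E\in\mathbb{R}^{d\times n}$ such that the resulting one-layer single-head Transformer satisfies $$\mathcal F\big(X^{(i)}+E\big)=\mathcal F^{(FF)}\big(\mathcal F^{(SA)}_S(X^{(i)}+E)\big)=Y^{(i)}\qquad\text{for all } i\in[N].$$ -/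

import Mathlib

open scoped Matrix

noncomputable section

namespace OneLayerTransformer

/-- Euclidean norm of the `k`-th column (token) of a sequence `Z`. -/
def tokenNorm {m n : ℕ} (Z : Matrix (Fin m) (Fin n) ℝ) (k : Fin n) : ℝ :=
  ‖WithLp.toLp 2 (Z.col k)‖

/-- Euclidean distance between two columns (tokens), possibly of different sequences. -/
def tokenDist {m n : ℕ} (Z Z' : Matrix (Fin m) (Fin n) ℝ) (k l : Fin n) : ℝ :=
  ‖WithLp.toLp 2 (Z.col k - Z'.col l)‖

/-- Tokenwise `(rmin, rmax, δ)`-separated sequences. -/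
structure TokenwiseSeparated {m n N : ℕ} (rmin rmax δ : ℝ)
    (Z : Fin N → Matrix (Fin m) (Fin n) ℝ) : Prop where
  lower : ∀ i k, rmin < tokenNorm (Z i) k
  upper : ∀ i k, tokenNorm (Z i) k < rmax
  sep : ∀ i j k l, (Z i).col k ≠ (Z j).col l → δ < tokenDist (Z i) (Z j) k l

/-- Column-wise softmax. -/
def softmaxCols {n : ℕ} (A : Matrix (Fin n) (Fin n) ℝ) : Matrix (Fin n) (Fin n) ℝ :=
  Matrix.of fun k l => Real.exp (A k l) / ∑ k', Real.exp (A k' l)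

/-- The ReLU activation. -/
def relu (x : ℝ) : ℝ := max x 0

/-- The weights of a Transformer block with embedding dimension `d`, head size `s`, `h` heads and
hidden units of the feed-forward part indexed by `Q` (hidden dimension `|Q|`). -/
structure Weights (d s h : ℕ) (Q : Type) where
  WO : Fin h → Matrix (Fin d) (Fin s) ℝ
  WV : Fin h → Matrix (Fin s) (Fin d) ℝ
  WK : Fin h → Matrix (Fin s) (Fin d) ℝ
  WQ : Fin h → Matrix (Fin s) (Fin d) ℝ
  W1 : Matrix Q (Fin d) ℝ
  b1 : Q → ℝ
  W2 : Matrix (Fin d) Q ℝ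
  b2 : Fin d → ℝ

namespace Weights

variable {d s h : ℕ} {Q : Type}

/-- Softmax self-attention with skip connection. -/
def selfAttention (W : Weights d s h Q) {n : ℕ} (Z : Matrix (Fin d) (Fin n) ℝ) :
    Matrix (Fin d) (Fin n) ℝ :=
  Z + ∑ i, W.WO i * (W.WV i * Z) * softmaxCols ((W.WK i * Z)ᵀ * (W.WQ i * Z))

/-- Token-wise feed-forward network with one hidden ReLU layer and skip connection. -/
def feedForward [Fintype Q] (W : Weights d s h Q) {n : ℕ} (H : Matrix (Fin d) (Fin n) ℝ) :
    Matrix (Fin d) (Fin n) ℝ :=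
  Matrix.of fun a k =>
    (H.col k + W.W2 *ᵥ (fun q => relu ((W.W1 *ᵥ H.col k + W.b1) q)) + W.b2) a

/-- The Transformer block. -/
def block [Fintype Q] (W : Weights d s h Q) {n : ℕ} (Z : Matrix (Fin d) (Fin n) ℝ) :
    Matrix (Fin d) (Fin n) ℝ :=
  W.feedForward (W.selfAttention Z)

end Weights

/-- Names of the free real parameters of the attention part: each of the four rank-one matrices
(`0 = O`, `1 = V`, `2 = K`, `3 = Q`) has one factor in `ℝ^d` and one in `ℝ^s`. -/
abbrev AttentionParam (d s : ℕ) : Type := Fin 4 × (Fin d ⊕ Fin s)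

/-- Names of the free real parameters of the feed-forward part: for each output coordinate, `m`
output weights, `m` biases, and one input direction in `ℝ^d` shared by the `m` hidden units. -/
abbrev FeedForwardParam (d m : ℕ) : Type := Fin d × ((Fin m ⊕ Fin m) ⊕ Fin d)

/-- Names of all free real parameters. -/
abbrev Param (d s m : ℕ) : Type := AttentionParam d s ⊕ FeedForwardParam d m

/-- The single-head Transformer block with free parameters `θ`. The attention matrices are outer
products. Hidden unit `(c, j)` of the feed-forward part reads its token through the direction
shared by all units `(c, ·)`, and writes to output coordinate `c` only; the outer bias is zero. -/
def ofParams {d s m : ℕ} (θ : Param d s m → ℝ) : Weights d s 1 (Fin d × Fin m) where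
  WO _ := Matrix.vecMulVec (fun a => θ (.inl (0, .inl a))) (fun t => θ (.inl (0, .inr t)))
  WV _ := Matrix.vecMulVec (fun t => θ (.inl (1, .inr t))) (fun a => θ (.inl (1, .inl a)))
  WK _ := Matrix.vecMulVec (fun t => θ (.inl (2, .inr t))) (fun a => θ (.inl (2, .inl a)))
  WQ _ := Matrix.vecMulVec (fun t => θ (.inl (3, .inr t))) (fun a => θ (.inl (3, .inl a)))
  W1 := Matrix.of fun q a => θ (.inr (q.1, .inr a))
  b1 := fun q => θ (.inr (q.1, .inl (.inr q.2)))
  W2 := Matrix.of fun c q => if q.1 = c then θ (.inr (c, .inl (.inl q.2))) else 0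
  b2 := 0

end OneLayerTransformer

end

namespace OneLayerTransformer

open Filter Topology

/-! The whole network sees tokens through one direction `g`, injective on the finitely many shifted
tokens. The encoding separates positions, so a sequence is determined by its set of projected
values. Attention adds to each token a multiple of `u`: the softmax mean of the projections, at
inverse temperature `τ` times the token's own projection. As a function of temperature this mean is
the logarithmic derivative of a sum of exponentials, so it determines the exponents
(`exists_eq_of_softmaxMean_eq`), hence the sequence. Being analytic, distinct means differ at all
small nonzero temperatures, so a single `τ` serves every token (`exists_scale_softmaxMean_ne`). A
generic `δ` packs projection and mean into one real number that fixes token, position and sequence,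
hence the label. ReLU interpolation at these at most `n * N` numbers, one output coordinate at a
time, finishes. -/

/-- Any finite set of `m` abscissae can be interpolated by a sum of `m` shifted ReLU units. -/
theorem exists_relu_interpolation (m : ℕ) (S : Finset ℝ) (hS : S.card ≤ m) (F : ℝ → ℝ) :
    ∃ w β : Fin m → ℝ, ∀ x ∈ S, ∑ j, w j * relu (x + β j) = F x := by
  induction m generalizing S with
  | zero =>
    have : S = ∅ := by simpa using hS
    subst this
    exact ⟨0, 0, by simp⟩
  | succ m ih =>
    rcases S.eq_empty_or_nonempty with rfl | hne
    · exact ⟨0, 0, by simp⟩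
    set M := S.max' hne with hM
    have hMS : M ∈ S := S.max'_mem hne
    obtain ⟨w, β, hw⟩ := ih (S.erase M) (by rw [Finset.card_erase_of_mem hMS]; omega)
    -- The new unit has its kink at `b`: it vanishes on all smaller points and only corrects the
    -- value at `M`.
    obtain ⟨b, hbM, hb⟩ : ∃ b < M, ∀ x ∈ S.erase M, x ≤ b := by
      rcases (S.erase M).eq_empty_or_nonempty with he | he
      · exact ⟨M - 1, by linarith, by simp [he]⟩
      · refine ⟨(S.erase M).max' he, ?_, fun x hx => Finset.le_max' _ x hx⟩
        exact S.lt_max'_of_mem_erase_max' hne ((S.erase M).max'_mem he)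
    have hpos : 0 < M - b := sub_pos.2 hbM
    refine ⟨Fin.cons ((F M - ∑ j, w j * relu (M + β j)) / (M - b)) w, Fin.cons (-b) β, ?_⟩
    intro x hx
    rw [Fin.sum_univ_succ]
    simp only [Fin.cons_zero, Fin.cons_succ]
    by_cases hxM : x = M
    · have hrelu : relu (M + -b) = M - b := by
        rw [relu, ← sub_eq_add_neg, max_eq_left hpos.le]
      rw [hxM, hrelu, div_mul_cancel₀ _ hpos.ne']
      ring
    · have hx' : x ∈ S.erase M := Finset.mem_erase.2 ⟨hxM, hx⟩
      have hrelu : relu (x + -b) = 0 := max_eq_right (by linarith [hb x hx'])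
      rw [hrelu, hw x hx']
      ring

/-- A finite family of real points with consistent targets can be interpolated by ReLU units, one
unit per point. -/
theorem exists_relu_interpolation_family {ι : Type*} [Fintype ι] (m : ℕ)
    (hm : Fintype.card ι ≤ m) (x T : ι → ℝ) (hT : ∀ i j, x i = x j → T i = T j) :
    ∃ w β : Fin m → ℝ, ∀ i, ∑ j, w j * relu (x i + β j) = T i := by
  classical
  obtain ⟨w, β, h⟩ := exists_relu_interpolation m (Finset.univ.image x)
    (Finset.card_image_le.trans hm) (Function.extend x T 0)
  refine ⟨w, β, fun i => ?_⟩
  rw [h _ (Finset.mem_image_of_mem x (Finset.mem_univ i))]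
  exact Function.FactorsThrough.extend_apply (fun a b hab => hT a b hab) 0 i

/-- A finite family of nonzero vectors has a direction orthogonal to none of them. -/
theorem exists_dotProduct_ne_zero {d : ℕ} {ι : Type*} [Finite ι] (v : ι → Fin d → ℝ)
    (hv : ∀ i, v i ≠ 0) : ∃ g : Fin d → ℝ, ∀ i, g ⬝ᵥ v i ≠ 0 := by
  obtain ⟨f, hf⟩ := Module.exists_dual_forall_apply_ne_zero (K := ℝ) v hv
  refine ⟨fun a => f (Pi.single a 1), fun i => ?_⟩
  convert hf i
  rw [LinearMap.pi_apply_eq_sum_univ f (v i)]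
  simp [dotProduct, mul_comm]
  refine Finset.sum_congr rfl fun a _ => ?_
  congr 2
  ext b
  simp [Pi.single_apply, eq_comm]

section Exponentials

variable {n : ℕ}

/-- The exponential `t ↦ exp (t * c)` as a character of the additive group of real numbers. -/
noncomputable def expCharacter (c : ℝ) : Multiplicative ℝ →* ℝ where
  toFun t := Real.exp (t.toAdd * c)
  map_one' := by simp
  map_mul' s t := by simp [add_mul, Real.exp_add]

theorem expCharacter_injective : Function.Injective expCharacter := by
  intro a b h
  have := congrArg (fun χ : Multiplicative ℝ →* ℝ => χ (Multiplicative.ofAdd 1)) h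
  simpa [expCharacter] using this

/-- Equal exponential sums have the same exponents. -/
theorem exists_eq_of_sum_exp_eq (a b : Fin n → ℝ)
    (h : ∀ t : ℝ, ∑ k, Real.exp (t * a k) = ∑ k, Real.exp (t * b k)) (m : Fin n) :
    ∃ l, b l = a m := by
  classical
  have hli := linearIndependent_monoidHom (Multiplicative ℝ) ℝ
  rw [linearIndependent_iff_injective_finsuppLinearCombination] at hli
  have heq : (∑ k, Finsupp.single (expCharacter (a k)) (1 : ℝ)) =
      ∑ k, Finsupp.single (expCharacter (b k)) (1 : ℝ) := by
    apply hli
    ext t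
    simpa [map_sum, Finsupp.linearCombination_single, expCharacter] using h t.toAdd
  -- The coefficient of a character counts its occurrences: at least one on the left, none on the
  -- right.
  by_contra! hb
  have hval := DFunLike.congr_fun heq (expCharacter (a m))
  simp only [Finsupp.finsetSum_apply, Finsupp.single_apply,
    expCharacter_injective.eq_iff, hb, if_false, Finset.sum_const_zero] at hval
  rw [Finset.sum_eq_zero_iff_of_nonneg (fun k _ => by split_ifs <;> norm_num)] at hval
  simpa using hval m (Finset.mem_univ m)

/-- The softmax-weighted mean of the values `a` at inverse temperature `t`. -/
noncomputable def softmaxMean (a : Fin n → ℝ) (t : ℝ) : ℝ :=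
  (∑ k, a k * Real.exp (t * a k)) / ∑ k, Real.exp (t * a k)

theorem sum_exp_pos (hn : 0 < n) (a : Fin n → ℝ) (t : ℝ) : 0 < ∑ k, Real.exp (t * a k) :=
  haveI : Nonempty (Fin n) := ⟨⟨0, hn⟩⟩
  Finset.sum_pos (fun _ _ => Real.exp_pos _) Finset.univ_nonempty

theorem hasDerivAt_sum_exp (a : Fin n → ℝ) (t : ℝ) :
    HasDerivAt (fun t => ∑ k, Real.exp (t * a k)) (∑ k, a k * Real.exp (t * a k)) t := by
  refine HasDerivAt.fun_sum fun k _ => ?_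
  simpa [mul_comm] using ((hasDerivAt_id t).mul_const (a k)).exp

/-- Softmax means that agree at every temperature come from the same values. -/
theorem exists_eq_of_softmaxMean_eq (hn : 0 < n) (a b : Fin n → ℝ)
    (h : softmaxMean a = softmaxMean b) (m : Fin n) : ∃ l, b l = a m := by
  refine exists_eq_of_sum_exp_eq a b (fun t => ?_) m
  -- Equal logarithmic derivatives make the quotient constant; at `t = 0` it is `n / n = 1`.
  have hd : ∀ t, HasDerivAt
      (fun t => (∑ k, Real.exp (t * a k)) / ∑ k, Real.exp (t * b k)) 0 t := by
    intro t
    have hab := congrFun h t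
    rw [softmaxMean, softmaxMean,
      div_eq_div_iff (sum_exp_pos hn a t).ne' (sum_exp_pos hn b t).ne'] at hab
    refine ((hasDerivAt_sum_exp a t).fun_div (hasDerivAt_sum_exp b t)
      (sum_exp_pos hn b t).ne').congr_deriv ?_
    rw [hab, mul_comm (∑ k, Real.exp (t * a k)), sub_self, zero_div]
  have hc := is_const_of_deriv_eq_zero (fun t => (hd t).differentiableAt) (fun t => (hd t).deriv) t 0
  have hn' : (n : ℝ) ≠ 0 := Nat.cast_ne_zero.2 hn.ne'
  simpa [hn', div_eq_one_iff_eq (sum_exp_pos hn b t).ne'] using hc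

theorem analyticOnNhd_softmaxMean (hn : 0 < n) (a : Fin n → ℝ) :
    AnalyticOnNhd ℝ (softmaxMean a) Set.univ := by
  intro t _
  unfold softmaxMean
  refine AnalyticAt.fun_div ?_ ?_ (sum_exp_pos hn a t).ne' <;>
  · refine Finset.analyticAt_fun_sum _ fun k _ => ?_
    fun_prop

/-- Distinct softmax means differ at all small nonzero inverse temperatures. -/
theorem eventually_softmaxMean_ne (hn : 0 < n) (a b : Fin n → ℝ)
    (h : softmaxMean a ≠ softmaxMean b) :
    ∀ᶠ t in 𝓝[≠] (0 : ℝ), softmaxMean a t ≠ softmaxMean b t := by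
  have ha := analyticOnNhd_softmaxMean hn a
  have hb := analyticOnNhd_softmaxMean hn b
  rcases ((ha 0 trivial).sub (hb 0 trivial)).eventually_eq_zero_or_eventually_ne_zero with h0 | h0
  · exact absurd (ha.eq_of_eventuallyEq hb (h0.mono fun t ht => sub_eq_zero.1 ht)) h
  · exact h0.mono fun t ht => sub_ne_zero.1 ht

/-- Finitely many distinct softmax means are told apart at finitely many nonzero temperatures
after a common rescaling. -/
theorem exists_scale_softmaxMean_ne {ι κ : Type*} [Finite ι] [Finite κ] (hn : 0 < n)
    (a : ι → Fin n → ℝ) (c : κ → ℝ) (hc : ∀ p, c p ≠ 0) :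
    ∃ τ : ℝ, ∀ i j p, softmaxMean (a i) ≠ softmaxMean (a j) →
      softmaxMean (a i) (τ * c p) ≠ softmaxMean (a j) (τ * c p) := by
  have hev : ∀ᶠ τ in 𝓝[≠] (0 : ℝ), ∀ i j p, softmaxMean (a i) ≠ softmaxMean (a j) →
      softmaxMean (a i) (τ * c p) ≠ softmaxMean (a j) (τ * c p) := by
    simp only [eventually_all]
    intro i j p hij
    have htend : Tendsto (fun τ : ℝ => τ * c p) (𝓝[≠] 0) (𝓝[≠] 0) := by
      refine tendsto_nhdsWithin_iff.2 ⟨?_, ?_⟩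
      · have : Tendsto (fun τ : ℝ => τ * c p) (𝓝 0) (𝓝 (0 * c p)) :=
          tendsto_id.mul_const _
        rw [zero_mul] at this
        exact this.mono_left nhdsWithin_le_nhds
      · filter_upwards [self_mem_nhdsWithin] with τ hτ
        exact mul_ne_zero hτ (hc p)
    exact htend.eventually (eventually_softmaxMean_ne hn _ _ hij)
  exact hev.exists

end Exponentials

/-- A generic linear combination of two functions on a finite set separates whatever the pair
separates. -/
theorem exists_add_mul_separating {ι : Type*} [Finite ι] (x y : ι → ℝ) :
    ∃ δ : ℝ, ∀ i j, x i + δ * y i = x j + δ * y j → x i = x j ∧ y i = y j := by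
  -- Each pair with `y i ≠ y j` collides for just one value of `δ`.
  obtain ⟨δ, hδ⟩ := (Set.finite_range
    fun p : ι × ι => (x p.2 - x p.1) / (y p.1 - y p.2)).exists_notMem
  refine ⟨δ, fun i j h => ?_⟩
  by_cases hy : y i = y j
  · exact ⟨by rw [hy] at h; linarith, hy⟩
  · refine absurd ⟨(i, j), ?_⟩ hδ
    rw [div_eq_iff (sub_ne_zero.2 hy)]
    linarith

/-- A positional encoding that makes all tokens nonzero and tokens at different positions
different. -/
theorem exists_positional_encoding {d n N : ℕ} (hd : 0 < d)
    (X : Fin N → Matrix (Fin d) (Fin n) ℝ) :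
    ∃ E : Matrix (Fin d) (Fin n) ℝ, (∀ i k, (X i + E).col k ≠ 0) ∧
      ∀ i j k l, (X i + E).col k = (X j + E).col l → k = l := by
  let a : Fin d := ⟨0, hd⟩
  obtain ⟨B, hB⟩ := (Set.finite_range fun p : Fin N × Fin n => |X p.1 a p.2|).bddAbove
  have hB' : ∀ i k, |X i a k| ≤ B := fun i k => hB ⟨(i, k), rfl⟩
  -- Shifts spaced wider than the range `[-B, B]` of the first coordinate cannot overlap.
  let c : ℝ := 2 * |B| + 1
  have hBc := le_abs_self B
  have hB0 := abs_nonneg B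
  have hc : 0 < c := by positivity
  refine ⟨Matrix.of fun _ k => c * ((k : ℝ) + 1), fun i k h => ?_, fun i j k l h => ?_⟩
  · have h0 : X i a k + c * ((k : ℝ) + 1) = 0 := by simpa using congrFun h a
    have h1 := abs_le.1 (hB' i k)
    have h2 : 0 ≤ c * (k : ℝ) := by positivity
    have h3 : c = 2 * |B| + 1 := rfl
    linarith
  · have h0 : X i a k + c * ((k : ℝ) + 1) = X j a l + c * ((l : ℝ) + 1) := by
      simpa using congrFun h a
    have h1 := abs_le.1 (hB' i k)
    have h2 := abs_le.1 (hB' j l)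
    have h3 : c = 2 * |B| + 1 := rfl
    have gap : ∀ {p q : Fin n}, p < q → c * ((p : ℝ) + 1) + c ≤ c * ((q : ℝ) + 1) := by
      intro p q hpq
      have : (p : ℝ) + 1 ≤ q := by exact_mod_cast hpq
      nlinarith
    rcases lt_trichotomy k l with hkl | hkl | hkl
    · linarith [gap hkl]
    · exact hkl
    · linarith [gap hkl]

/-- The parameters of the attention matrices `WO = u ⊗ e`, `WV = e ⊗ g`, `WK = e ⊗ τ g`,
`WQ = e ⊗ g` for a coordinate vector `e`, and of feed-forward units sharing the direction `g`. -/
noncomputable def params {d s m : ℕ} (e : Fin s) (u g : Fin d → ℝ) (τ : ℝ) (w β : Fin d → Fin m → ℝ) :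
    Param d s m → ℝ
  | .inl (r, .inl a) => if r = 0 then u a else if r = 2 then τ * g a else g a
  | .inl (_, .inr t) => Pi.single (M := fun _ => ℝ) e 1 t
  | .inr (c, .inl (.inl j)) => w c j
  | .inr (c, .inl (.inr j)) => β c j
  | .inr (_, .inr a) => g a

section Params

variable {d s m n : ℕ} (e : Fin s) (u g : Fin d → ℝ) (τ : ℝ) (w β : Fin d → Fin m → ℝ)

/-- Since `e` is a unit vector, the score of key `k` for query `l` is `τ (g ⬝ᵥ z_l) (g ⬝ᵥ z_k)`: the
query only sets the temperature. -/
theorem selfAttention_params (Z : Matrix (Fin d) (Fin n) ℝ) (a : Fin d) (l : Fin n) :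
    (ofParams (params e u g τ w β)).selfAttention Z a l =
      Z a l + u a * softmaxMean (fun k => g ⬝ᵥ Z.col k) (τ * (g ⬝ᵥ Z.col l)) := by
  have hK : ∀ k t, ((ofParams (params e u g τ w β)).WK 0 * Z) t k =
      Pi.single (M := fun _ => ℝ) e 1 t * (τ * (g ⬝ᵥ Z.col k)) := by
    intro k t
    simp [ofParams, params, Matrix.mul_apply, Matrix.vecMulVec_apply, dotProduct,
      Finset.mul_sum, mul_assoc]
  have hQ : ∀ k t, ((ofParams (params e u g τ w β)).WQ 0 * Z) t k =
      Pi.single (M := fun _ => ℝ) e 1 t * (g ⬝ᵥ Z.col k) := by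
    intro k t
    simp [ofParams, params, Matrix.mul_apply, Matrix.vecMulVec_apply, dotProduct,
      Finset.mul_sum, mul_assoc]
  have hV : ∀ k t, ((ofParams (params e u g τ w β)).WV 0 * Z) t k =
      Pi.single (M := fun _ => ℝ) e 1 t * (g ⬝ᵥ Z.col k) := by
    intro k t
    simp [ofParams, params, Matrix.mul_apply, Matrix.vecMulVec_apply, dotProduct,
      Finset.mul_sum, mul_assoc]
  have hO : ∀ t, (ofParams (params e u g τ w β)).WO 0 a t =
      u a * Pi.single (M := fun _ => ℝ) e 1 t := by
    intro t
    simp [ofParams, params, Matrix.vecMulVec_apply]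
  have hS : ∀ k, (((ofParams (params e u g τ w β)).WK 0 * Z)ᵀ *
      ((ofParams (params e u g τ w β)).WQ 0 * Z)) k l =
      τ * (g ⬝ᵥ Z.col l) * (g ⬝ᵥ Z.col k) := by
    intro k
    rw [Matrix.mul_apply]
    simp only [Matrix.transpose_apply, hK, hQ, Pi.single_apply]
    simp
    ring
  have hOV : ∀ k, ((ofParams (params e u g τ w β)).WO 0 *
      ((ofParams (params e u g τ w β)).WV 0 * Z)) a k = u a * (g ⬝ᵥ Z.col k) := by
    intro k
    rw [Matrix.mul_apply]
    simp only [hO, hV, Pi.single_apply]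
    simp
  rw [Weights.selfAttention, Fin.sum_univ_one, Matrix.add_apply, Matrix.mul_apply]
  simp only [hOV, softmaxCols, Matrix.of_apply, hS, softmaxMean]
  rw [Finset.sum_div, Finset.mul_sum]
  congr 1
  exact Finset.sum_congr rfl fun k _ => by ring

theorem feedForward_params (H : Matrix (Fin d) (Fin n) ℝ) (a : Fin d) (l : Fin n) :
    (ofParams (params e u g τ w β)).feedForward H a l =
      H a l + ∑ j, w a j * relu (g ⬝ᵥ H.col l + β a j) := by
  simp only [Weights.feedForward, ofParams, params, Matrix.of_apply, Pi.add_apply, Pi.zero_apply,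
    add_zero, Matrix.mulVec, Matrix.col_apply]
  congr 1
  rw [dotProduct, Fintype.sum_prod_type, Finset.sum_eq_single a]
  · simp [dotProduct]
  · intro c _ hc
    simp [hc]
  · simp

end Params

theorem card_param (d s n N : ℕ) :
    Fintype.card (Param d s (n * N)) = 4 * (s + d) + d * (2 * n * N + d) := by
  simp only [Fintype.card_sum, Fintype.card_prod, Fintype.card_fin]
  ring

end OneLayerTransformer

theorem corollary5 (d n N s C : ℕ) (hs : 1 ≤ s)
    (ε rmin rmax : ℝ) (hε : 0 < ε) (hrmin : 0 < rmin) (hr : rmin < rmax)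
    (X : Fin N → Matrix (Fin d) (Fin n) ℝ) (Y : Fin N → Matrix (Fin d) (Fin n) ℕ)
    (hY : ∀ i a k, Y i a k ∈ Set.Icc 1 C)
    (hX : OneLayerTransformer.TokenwiseSeparated rmin rmax ε X)
    (hXY : ∀ i j, X i = X j → Y i = Y j) :
    Fintype.card (OneLayerTransformer.Param d s (n * N)) = 4 * (s + d) + d * (2 * n * N + d) ∧
    ∃ (θ : OneLayerTransformer.Param d s (n * N) → ℝ) (E : Matrix (Fin d) (Fin n) ℝ),
      ∀ i, (OneLayerTransformer.ofParams θ).block (X i + E) =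
        (Y i).map (fun y : ℕ => (y : ℝ)) := by
  refine ⟨OneLayerTransformer.card_param d s n N, ?_⟩
  rcases Nat.eq_zero_or_pos d with rfl | hd
  · exact ⟨0, 0, fun i => Matrix.ext fun a => a.elim0⟩
  rcases Nat.eq_zero_or_pos n with rfl | hn
  · exact ⟨0, 0, fun i => Matrix.ext fun _ k => k.elim0⟩
  rcases Nat.eq_zero_or_pos N with rfl | hN
  · exact ⟨0, 0, fun i => i.elim0⟩
  obtain ⟨E, hE0, hEpos⟩ := OneLayerTransformer.exists_positional_encoding hd X
  let z : Fin N × Fin n → Fin d → ℝ := fun p => (X p.1 + E).col p.2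
  -- Tokens are included to get nonzero temperatures, differences to get injectivity.
  obtain ⟨g, hg⟩ := OneLayerTransformer.exists_dotProduct_ne_zero
    (Sum.elim z fun q : {q : (Fin N × Fin n) × (Fin N × Fin n) // z q.1 ≠ z q.2} =>
      z q.1.1 - z q.1.2)
    (by
      rintro (p | q)
      · exact hE0 p.1 p.2
      · exact sub_ne_zero.2 q.2)
  have hg0 : ∀ p, g ⬝ᵥ z p ≠ 0 := fun p => hg (.inl p)
  have hginj : ∀ p q, g ⬝ᵥ z p = g ⬝ᵥ z q → z p = z q := by
    intro p q h
    by_contra hne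
    refine hg (.inr ⟨(p, q), hne⟩) ?_
    simp [dotProduct_sub, h]
  let b : Fin N → Fin n → ℝ := fun i k => g ⬝ᵥ z (i, k)
  have hcol : ∀ i j k l, b i k = b j l → k = l ∧ (X i).col k = (X j).col k := by
    intro i j k l h
    have hz := hginj (i, k) (j, l) h
    obtain rfl := hEpos i j k l hz
    refine ⟨rfl, funext fun a => ?_⟩
    have := congrFun hz a
    simpa [z] using this
  have hmean : ∀ i j, OneLayerTransformer.softmaxMean (b i) = OneLayerTransformer.softmaxMean (b j) →
      X i = X j := by
    intro i j h
    refine Matrix.ext fun a k => ?_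
    obtain ⟨l, hl⟩ := OneLayerTransformer.exists_eq_of_softmaxMean_eq hn _ _ h k
    exact congrFun (hcol i j k l hl.symm).2 a
  obtain ⟨τ, hτ⟩ := OneLayerTransformer.exists_scale_softmaxMean_ne hn b
    (fun p : Fin N × Fin n => g ⬝ᵥ z p) hg0
  let f : Fin N × Fin n → ℝ := fun p =>
    OneLayerTransformer.softmaxMean (b p.1) (τ * (g ⬝ᵥ z p))
  obtain ⟨δ, hδ⟩ := OneLayerTransformer.exists_add_mul_separating (fun p => g ⬝ᵥ z p) f
  have hgg : g ⬝ᵥ g ≠ 0 := by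
    intro h
    rw [dotProduct_self_eq_zero] at h
    exact hg0 (⟨0, hN⟩, ⟨0, hn⟩) (by simp [h])
  -- Scaled so that reading the attention output along `g` weights the mean by exactly `δ`.
  let u : Fin d → ℝ := (δ / (g ⬝ᵥ g)) • g
  have hgu : g ⬝ᵥ u = δ := by
    simp only [u, dotProduct_smul, smul_eq_mul]
    exact div_mul_cancel₀ _ hgg
  let x : Fin N × Fin n → ℝ := fun p => g ⬝ᵥ z p + δ * f p
  -- The target subtracts the attention output, which the skip connection adds back.
  let T : Fin d → Fin N × Fin n → ℝ := fun a p => (Y p.1 a p.2 : ℝ) - (z p a + u a * f p)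
  have hT : ∀ a p q, x p = x q → T a p = T a q := by
    rintro a ⟨i, k⟩ ⟨j, l⟩ h
    obtain ⟨h1, h2⟩ := hδ _ _ h
    have hz := hginj _ _ h1
    obtain rfl := (hcol i j k l h1).1
    have hXij : X i = X j := by
      refine hmean i j ?_
      by_contra hne
      -- Equal tokens give equal temperatures, so both means are compared at the same point.
      refine hτ i j (i, k) hne ?_
      simpa only [f, hz] using h2
    simp only [T, hz, h2, hXY i j hXij]
  choose w β hw using fun a => OneLayerTransformer.exists_relu_interpolation_family (n * N)
    (by simp [mul_comm]) x (T a) (hT a)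
  refine ⟨OneLayerTransformer.params ⟨0, hs⟩ u g τ w β, E, fun i => Matrix.ext fun a l => ?_⟩
  have hH : ((OneLayerTransformer.ofParams
      (OneLayerTransformer.params ⟨0, hs⟩ u g τ w β)).selfAttention (X i + E)).col l =
      z (i, l) + f (i, l) • u := by
    funext c
    rw [Matrix.col_apply, OneLayerTransformer.selfAttention_params, Pi.add_apply, Pi.smul_apply,
      smul_eq_mul, mul_comm (f _)]
    rfl
  have hx : g ⬝ᵥ (z (i, l) + f (i, l) • u) = x (i, l) := by
    rw [dotProduct_add, dotProduct_smul, hgu, smul_eq_mul, mul_comm]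
  rw [OneLayerTransformer.Weights.block, OneLayerTransformer.feedForward_params, hH, hx, hw]
  have hHa := congrFun hH a
  rw [Matrix.col_apply] at hHa
  rw [hHa]
  simp only [T, Pi.add_apply, Pi.smul_apply, smul_eq_mul, Matrix.map_apply]
  ring
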